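/- Let $S$ be a Polish space with its Borel $\sigma$-algebra, $\mathcal P(S)$ the Borel probability measures on $S$, and $C_b(S)$ the bounded continuous real functions on $S$. Let $c:S\times S\to[0,\infty]$ be symmetric and such that (a) there is a nonempty $Q\subset C_b(S)$ with $c(x,y)=\sup_{u\in Q}(u(x)-u(y))$ for all $x,y\in S$; (b) the set $\Gamma_0=\mathrm{Lip}(c,S;C_b(S))=\{f\in C_b(S): f(x)-f(y)\le c(x,y)\text{ for all }x,y\in S\}$ is measure determining: for all $\mu\ne\nu$ in $\mathcal P(S)$ there is $f\in\Gamma_0$ with $\int f\,d\mu\neq\int f\,d\nu$; (c) there is $a:S\to[0,\infty)$ with $c(x,y)\le a(x)+a(y)$ for all $x,y\in S$. For $\Gamma\subset C_b(S)$ and $\mu,\nu,\gamma\in\mathcal P(S)$ put $$G_\Gamma(\mu\|\nu)=\sup_{g\in\Gamma}\Big\{\int g\,d\mu-\log\int e^g\,d\nu\Big\},\qquad W_\Gamma(\mu,\gamma)=\sup_{g\in\Gamma}\Big\{\int g\,d\mu-\int g\,d\gamma\Big\},$$ let $R(\gamma\|\nu)=\int\log\frac{d\gamma}{d\nu}\,d\gamma$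 if $\gamma\ll\nu$ and $R(\gamma\|\nu)=\infty$ otherwise, and let $b\Gamma_0=\{bf:f\in\Gamma_0\}$. Theorem. Let $\mu,\nu\in\mathcal P(S)$ have finite supports $\mathrm{supp}(\nu)=\{x_i\}_{1\le i\le N}$ and $\mathrm{supp}(\mu)=\{y_j\}_{1\le j\le M}$, where the $x_i$ are distinct and the $y_j$ are distinct. Then there is $\gamma^*\in\mathcal P(S)$ with $\gamma^*\ll\nu$ such that $W_{\Gamma_0}(\mu,\gamma^*)<\infty$, $R(\gamma^*\|\nu)<\infty$, and for all $b>0$ $$G_{b\Gamma_0}(\mu\|\nu)=b\,W_{\Gamma_0}(\mu,\gamma^*)+R(\gamma^*\|\nu)+\varepsilon(b),\qquad \varepsilon(b)\le 0,\qquad \varepsilon(b)\to0\ \text{ as } b\to\infty.$$ This $\gamma^*$ is the only $\gamma\in\mathcal P(S)$ with $\gamma\ll\nu$ for which such an expansion holds, and it is characterized as the unique minimizer of $R(\gamma\|\nu)$ over all $\gamma\in\mathcal P(S)$ that satisfy $$W_{\Gamma_0}(\mu,\gamma)=\inf_{\theta\in\mathcal P(S),\ \theta\ll\nu}W_{\Gamma_0}(\mu,\theta).$$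 If moreover $c(y_j,x_i)\ne c(y_j,x_l)$ for all $1\le j\le M$ and all $1\le i\ne l\le N$, then for $1\le i\le N$ $$\gamma^*(\{x_i\})=\sum_{j\in S_i}\mu(\{y_j\}),$$ where $S_i$ is the set of indices $j$ for which $x_i$ is the point of $\{x_l\}_{1\le l\le N}$ closest to $y_j$, that is, $c(y_j,x_i)\le c(y_j,x_l)$ for all $l$. -/

import Mathlib

open MeasureTheory Filter Topology InformationTheory
open scoped BoundedContinuousFunction ENNReal Pointwise

/-- The cost `c` is represented by a nonempty family `Q` of bounded continuous functions:
`c(x, y) = sup_{u ∈ Q} (u(x) - u(y))` for all `x, y`. -/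
def CostRepresentation {S : Type*} [TopologicalSpace S] (c : S → S → ℝ≥0∞) : Prop :=
  ∃ Q : Set (S →ᵇ ℝ), Q.Nonempty ∧
    ∀ x y : S, (c x y : EReal) = ⨆ u ∈ Q, ((u x - u y : ℝ) : EReal)

/-- `Lip(c, S; C_b(S))`: the bounded continuous `f` with `f(x) - f(y) ≤ c(x, y)` for all `x, y`. -/
def lipCb {S : Type*} [TopologicalSpace S] (c : S → S → ℝ≥0∞) : Set (S →ᵇ ℝ) :=
  {f | ∀ x y : S, ((f x - f y : ℝ) : EReal) ≤ (c x y : EReal)}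

/-- A set `Γ` of bounded continuous functions is determining for probability measures:
two distinct probability measures are told apart by the integral of some `g ∈ Γ`. -/
def MeasureDetermining {S : Type*} [TopologicalSpace S] [MeasurableSpace S]
    (Γ : Set (S →ᵇ ℝ)) : Prop :=
  ∀ μ ν : ProbabilityMeasure S, μ ≠ ν →
    ∃ g ∈ Γ, ∫ s, g s ∂(μ : Measure S) ≠ ∫ s, g s ∂(ν : Measure S)

/-- The `Γ`-divergence
`G_Γ(μ‖ν) = sup_{g ∈ Γ} (∫ g dμ - log ∫ e^g dν)`, with values in the extended reals. -/
noncomputable def gammaDivergence {S : Type*} [TopologicalSpace S] [MeasurableSpace S]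
    (Γ : Set (S →ᵇ ℝ)) (μ ν : ProbabilityMeasure S) : EReal :=
  ⨆ g ∈ Γ, ((∫ s, g s ∂(μ : Measure S) - Real.log (∫ s, Real.exp (g s) ∂(ν : Measure S)) : ℝ) :
    EReal)

/-- `W_Γ(μ, γ) = sup_{g ∈ Γ} ∫ g d(μ - γ)`, with values in the extended reals. -/
noncomputable def gammaTransport {S : Type*} [TopologicalSpace S] [MeasurableSpace S]
    (Γ : Set (S →ᵇ ℝ)) (μ γ : ProbabilityMeasure S) : EReal :=
  ⨆ g ∈ Γ, ((∫ s, g s ∂(μ : Measure S) - ∫ s, g s ∂(γ : Measure S) : ℝ) : EReal)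

/-- The relative entropy `R(γ‖ν)`: it is `∫ log (dγ/dν) dγ` if `γ ≪ ν` and `∞` otherwise. -/
noncomputable def relEntropy {S : Type*} [MeasurableSpace S]
    (γ ν : ProbabilityMeasure S) : EReal :=
  ((klDiv (γ : Measure S) (ν : Measure S) : ℝ≥0∞) : EReal)

/-- The smallest value of `W_Γ(μ, θ)` over the probability measures `θ ≪ ν`. -/
noncomputable def minTransport {S : Type*} [TopologicalSpace S] [MeasurableSpace S]
    (Γ : Set (S →ᵇ ℝ)) (μ ν : ProbabilityMeasure S) : EReal :=
  ⨅ (θ : ProbabilityMeasure S) (_ : (θ : Measure S) ≪ (ν : Measure S)), gammaTransport Γ μ θ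

/-- `γ` minimizes `R(·‖ν)` over the probability measures `γ'` that satisfy
`W_Γ(μ, γ') = inf_{θ ≪ ν} W_Γ(μ, θ)`. -/
def IsEntropyMinimizer {S : Type*} [TopologicalSpace S] [MeasurableSpace S]
    (Γ : Set (S →ᵇ ℝ)) (μ ν γ : ProbabilityMeasure S) : Prop :=
  gammaTransport Γ μ γ = minTransport Γ μ ν ∧
    ∀ γ' : ProbabilityMeasure S, gammaTransport Γ μ γ' = minTransport Γ μ ν →
      relEntropy γ ν ≤ relEntropy γ' ν

/-- The expansion `G_{bΓ}(μ‖ν) = b W_Γ(μ, γ) + R(γ‖ν) + err(b)` for all `b > 0`, where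
`W_Γ(μ, γ)` and `R(γ‖ν)` are finite, `err ≤ 0`, and `err(b) → 0` as `b → ∞`. -/
def HasScalingExpansion {S : Type*} [TopologicalSpace S] [MeasurableSpace S]
    (Γ : Set (S →ᵇ ℝ)) (μ ν γ : ProbabilityMeasure S) : Prop :=
  gammaTransport Γ μ γ ≠ ⊤ ∧ relEntropy γ ν ≠ ⊤ ∧
    ∃ err : ℝ → ℝ,
      (∀ b : ℝ, 0 < b → gammaDivergence (b • Γ) μ ν =
        (b : EReal) * gammaTransport Γ μ γ + relEntropy γ ν + (err b : EReal)) ∧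
      (∀ b : ℝ, 0 < b → err b ≤ 0) ∧
      Tendsto err atTop (𝓝 0)

open scoped Classical in
/-- The indices `j` for which `x i` is a point among the `x l` that is closest to `y j`, where
closeness is measured by the cost `c`. -/
noncomputable def nearestIndices {S : Type*} (c : S → S → ℝ≥0∞) {N M : ℕ}
    (x : Fin N → S) (y : Fin M → S) (i : Fin N) : Finset (Fin M) :=
  Finset.univ.filter fun j => ∀ l : Fin N, c (y j) (x i) ≤ c (y j) (x l)

/-! Only values at the points `x i` and `y j` matter. A function on these points that is Lipschitz
for `c` becomes, after multiplication by any `k < 1`, the restriction of a member of `lipCb c`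
(`exists_mem_lipCb_extension`). Letting `k → 1` turns both suprema into maxima over a compact set of
vectors: `W` becomes a convex continuous function `V` of the weights `p` of `γ`, and the relative
entropy becomes a strictly convex continuous function `R` of `p`.

The core is the duality `G_b = min_p (b V(p) + R(p))`. Gibbs' inequality gives `≤`. For `≥`, the
Gibbs weights of a maximizer `g` of the objective are used: the first-order condition at `g` says
exactly that `g` is optimal for `V` at these weights (`exists_discreteObjective_ge`).

Let `p₀` minimize `R` among the minimizers of `V`; strict convexity makes it unique. As `b` grows,
the penalty `b V` forces the minimum value towards `b V(p₀) + R(p₀)` (`tendsto_penalized_sub`).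
Another expansion would have the same slope and intercept, hence the same `V` and `R`, hence the
same weights. When nearest points are unique, perturbing the distance to the `x i` identifies `p₀`
(`eq_sum_of_discreteTransport_le`). -/

/-! ### Penalized minimization on a compact set -/

/-- If `p₀` is the unique minimizer of `R` among the minimizers of `V` on a compact set, then
near-minimizers `p b` of `b V + R` satisfy `b V (p b) + R (p b) - (b V p₀ + R p₀) → 0`. -/
theorem tendsto_penalized_sub {X : Type*} [TopologicalSpace X] {P : Set X} (hP : IsCompact P)
    {V R : X → ℝ} (hV : ContinuousOn V P) (hR : ContinuousOn R P) {p₀ : X}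
    (hmin : ∀ q ∈ P, V p₀ ≤ V q)
    (hR₀ : ∀ q ∈ P, V q ≤ V p₀ → R p₀ ≤ R q) {G : ℝ → ℝ}
    (hG : ∀ b, 0 < b → G b ≤ b * V p₀ + R p₀)
    (hGp : ∀ b, 0 < b → ∃ p ∈ P, b * V p + R p ≤ G b) :
    Tendsto (fun b => G b - (b * V p₀ + R p₀)) atTop (𝓝 0) := by
  -- The difference is nonpositive by `hG`, so only a lower bound is at stake. It holds as soon as
  -- the near-minimizer lies outside the compact set `T` where `R` drops by at least `ε`.
  have key : ∀ ε > 0, ∀ᶠ b : ℝ in atTop, -ε < G b - (b * V p₀ + R p₀) := by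
    intro ε hε
    set T : Set X := {p ∈ P | R p ≤ R p₀ - ε} with hT
    have hTc : IsCompact T := by
      obtain ⟨F, hF, hFe⟩ := continuousOn_iff_isClosed.1 hR _ (isClosed_Iic (a := R p₀ - ε))
      have : T = P ∩ F := by
        ext p
        have := Set.ext_iff.1 hFe p
        simp only [Set.mem_inter_iff, Set.mem_preimage, Set.mem_Iic] at this
        simp only [hT, Set.mem_ofPred_eq, Set.mem_inter_iff]
        tauto
      rw [this]
      exact hP.inter_right hF
    rcases T.eq_empty_or_nonempty with hTe | hTn
    · filter_upwards [eventually_gt_atTop 0] with b hb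
      obtain ⟨p, hp, hpb⟩ := hGp b hb
      have h1 : ¬ R p ≤ R p₀ - ε := fun h => by
        have : p ∈ T := ⟨hp, h⟩
        simp [hTe] at this
      have := mul_le_mul_of_nonneg_left (hmin p hp) hb.le
      linarith
    · obtain ⟨q, hqT, hq⟩ := hTc.exists_isMinOn hTn (hV.mono fun p hp => hp.1)
      obtain ⟨r, hrT, hr⟩ := hTc.exists_isMinOn hTn (hR.mono fun p hp => hp.1)
      have hqV : V p₀ < V q := by
        by_contra h
        have := hR₀ q hqT.1 (not_lt.1 h)
        have := hqT.2
        linarith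
      -- On `T` the loss in `V` is at least `V q - V p₀ > 0` and the gain in `R` at most `R p₀ - R
      -- r`; beyond this threshold the weighted loss exceeds the gain.
      filter_upwards [eventually_gt_atTop 0,
        eventually_gt_atTop ((R p₀ - R r) / (V q - V p₀))] with b hb hb'
      rw [div_lt_iff₀ (by linarith)] at hb'
      obtain ⟨p, hp, hpb⟩ := hGp b hb
      have h1 : ¬ R p ≤ R p₀ - ε := fun h => by
        have hpT : p ∈ T := ⟨hp, h⟩
        have h2 : V q ≤ V p := hq hpT
        have h3 : R r ≤ R p := hr hpT
        have := hG b hb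
        have := mul_le_mul_of_nonneg_left h2 hb.le
        linarith
      have := mul_le_mul_of_nonneg_left (hmin p hp) hb.le
      linarith
  rw [Metric.tendsto_nhds]
  intro ε hε
  filter_upwards [key ε hε, eventually_gt_atTop 0] with b hb hb0
  have := hG b hb0
  rw [Real.dist_eq, sub_zero, abs_lt]
  constructor <;> linarith

/-- Two affine functions with the same asymptotics at infinity coincide. -/
theorem affine_eq_of_tendsto_sub {v r v' r' : ℝ}
    (h : Tendsto (fun b : ℝ => b * v + r - (b * v' + r')) atTop (𝓝 0)) : v = v' ∧ r = r' := by
  -- Division by `b` isolates the slopes; once these agree, the difference is the constant `r - r'`.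
  have h1 : Tendsto (fun b : ℝ => b⁻¹ * (b * v + r - (b * v' + r'))) atTop (𝓝 (0 * 0)) :=
    tendsto_inv_atTop_zero.mul h
  have h2 : Tendsto (fun b : ℝ => (v - v') + b⁻¹ * (r - r')) atTop (𝓝 ((v - v') + 0 * (r - r'))) :=
    tendsto_const_nhds.add (tendsto_inv_atTop_zero.mul tendsto_const_nhds)
  have h3 : v = v' := by
    have := tendsto_nhds_unique (h1.congr' ?_) h2
    · linarith
    · filter_upwards [eventually_gt_atTop 0] with b hb
      field_simp
      ring
  refine ⟨h3, ?_⟩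
  subst h3
  have h4 : Tendsto (fun _ : ℝ => r - r') atTop (𝓝 0) := h.congr fun b => by ring
  have := tendsto_nhds_unique h4 tendsto_const_nhds
  linarith

/-! ### Relative entropy and transport on a finite set -/

section Discrete

variable {ι κ : Type*} [Fintype ι] [Fintype κ]

/-- The relative entropy `∑ i, p i log (p i / w i)` of weights. -/
noncomputable def discreteEntropy (w p : ι → ℝ) : ℝ := ∑ i, p i * Real.log (p i / w i)

/-- The logarithm may be split even where `p i = 0`, because the factor `p i` kills the term. In
this form continuity and strict convexity come from `t log t`. -/
theorem discreteEntropy_eq_sum {w : ι → ℝ} (hw : ∀ i, 0 < w i) (p : ι → ℝ) :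
    discreteEntropy w p = ∑ i, (p i * Real.log (p i) - p i * Real.log (w i)) := by
  refine Finset.sum_congr rfl fun i _ => ?_
  by_cases h : p i = 0
  · simp [h]
  · rw [Real.log_div h (hw i).ne']
    ring

theorem continuous_discreteEntropy {w : ι → ℝ} (hw : ∀ i, 0 < w i) :
    Continuous (discreteEntropy w) := by
  rw [funext (discreteEntropy_eq_sum hw)]
  refine continuous_finsetSum _ fun i _ => ?_
  exact (Real.continuous_mul_log.comp (continuous_apply i)).sub
    ((continuous_apply i).mul continuous_const)

theorem discreteEntropy_midpoint_lt {w : ι → ℝ} (hw : ∀ i, 0 < w i) {p q : ι → ℝ}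
    (hp : p ∈ stdSimplex ℝ ι) (hq : q ∈ stdSimplex ℝ ι) (hpq : p ≠ q) :
    discreteEntropy w ((1 / 2 : ℝ) • p + (1 / 2 : ℝ) • q) <
      1 / 2 * discreteEntropy w p + 1 / 2 * discreteEntropy w q := by
  simp only [discreteEntropy_eq_sum hw, Finset.mul_sum, ← Finset.sum_add_distrib]
  have hc := Real.strictConvexOn_mul_log
  obtain ⟨k, hk⟩ := Function.ne_iff.1 hpq
  refine Finset.sum_lt_sum (fun i _ => ?_) ⟨k, Finset.mem_univ k, ?_⟩
  · have := hc.convexOn.2 (Set.mem_Ici.2 (hp.1 i)) (Set.mem_Ici.2 (hq.1 i))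
      (by norm_num : (0 : ℝ) ≤ 1 / 2) (by norm_num : (0 : ℝ) ≤ 1 / 2) (by norm_num)
    simp only [smul_eq_mul, Pi.add_apply, Pi.smul_apply] at this ⊢
    linarith
  · have := hc.2 (Set.mem_Ici.2 (hp.1 k)) (Set.mem_Ici.2 (hq.1 k)) hk
      (by norm_num : (0 : ℝ) < 1 / 2) (by norm_num : (0 : ℝ) < 1 / 2) (by norm_num)
    simp only [smul_eq_mul, Pi.add_apply, Pi.smul_apply] at this ⊢
    linarith

/-- Gibbs' variational inequality on a finite set. -/
theorem sum_mul_sub_log_sum_exp_le {w p : ι → ℝ} (hw : ∀ i, 0 < w i)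
    (hp : p ∈ stdSimplex ℝ ι) (h : ι → ℝ) :
    ∑ i, p i * h i - Real.log (∑ i, w i * Real.exp (h i)) ≤ discreteEntropy w p := by
  set Z := ∑ i, w i * Real.exp (h i) with hZ
  have hne : (Finset.univ : Finset ι).Nonempty := by
    by_contra hn
    have := hp.2
    simp [Finset.not_nonempty_iff_eq_empty.1 hn] at this
  have hZ0 : 0 < Z := Finset.sum_pos (fun i _ => mul_pos (hw i) (Real.exp_pos _)) hne
  -- This is `log t ≤ t - 1` at `t = w i * exp (h i) / (Z * p i)`, multiplied by `p i`. The
  -- right-hand sides sum to `1 - 1 = 0`.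
  have key : ∀ i, p i * h i - p i * Real.log Z - p i * Real.log (p i / w i)
      ≤ w i * Real.exp (h i) / Z - p i := by
    intro i
    have hwi := hw i
    have he := Real.exp_pos (h i)
    rcases (hp.1 i).eq_or_lt with h0 | h0
    · rw [← h0]
      simp only [zero_mul, sub_zero]
      positivity
    · have h1 := Real.log_le_sub_one_of_pos
        (show 0 < w i * Real.exp (h i) / (Z * p i) by positivity)
      rw [Real.log_div (by positivity) (by positivity), Real.log_mul hwi.ne' he.ne',
        Real.log_mul hZ0.ne' h0.ne', Real.log_exp] at h1
      rw [Real.log_div h0.ne' hwi.ne']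
      have h2 := mul_le_mul_of_nonneg_left h1 h0.le
      have h3 : p i * (w i * Real.exp (h i) / (Z * p i) - 1) =
          w i * Real.exp (h i) / Z - p i := by
        field_simp
      linarith
  have h1 := Finset.sum_le_sum fun i (_ : i ∈ Finset.univ) => key i
  simp only [Finset.sum_sub_distrib, ← Finset.sum_div, ← Finset.sum_mul] at h1
  rw [← hZ, div_self hZ0.ne', hp.2] at h1
  unfold discreteEntropy
  linarith

/-- The Gibbs weights attain equality in Gibbs' variational inequality. -/
theorem discreteEntropy_gibbs {w : ι → ℝ} (hw : ∀ i, 0 < w i) [Nonempty ι] (h : ι → ℝ) :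
    discreteEntropy w (fun i => w i * Real.exp (h i) / ∑ k, w k * Real.exp (h k)) =
      ∑ i, w i * Real.exp (h i) / (∑ k, w k * Real.exp (h k)) * h i -
        Real.log (∑ k, w k * Real.exp (h k)) := by
  set Z := ∑ i, w i * Real.exp (h i) with hZ
  have hZ0 : 0 < Z :=
    Finset.sum_pos (fun i _ => mul_pos (hw i) (Real.exp_pos _)) Finset.univ_nonempty
  have h1 : ∑ i, w i * Real.exp (h i) / Z = 1 := by
    rw [← Finset.sum_div, ← hZ, div_self hZ0.ne']
  have h2 : Real.log Z = ∑ i, w i * Real.exp (h i) / Z * Real.log Z := by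
    rw [← Finset.sum_mul, h1, one_mul]
  rw [h2, ← Finset.sum_sub_distrib]
  refine Finset.sum_congr rfl fun i _ => ?_
  have hwi := hw i
  have : w i * Real.exp (h i) / Z / w i = Real.exp (h i) / Z := by
    field_simp
  rw [this, Real.log_div (Real.exp_pos _).ne' hZ0.ne', Real.log_exp]
  ring

theorem gibbs_mem_stdSimplex {w : ι → ℝ} (hw : ∀ i, 0 < w i) [Nonempty ι] (h : ι → ℝ) :
    (fun i => w i * Real.exp (h i) / ∑ k, w k * Real.exp (h k)) ∈ stdSimplex ℝ ι := by
  have hZ0 : 0 < ∑ i, w i * Real.exp (h i) :=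
    Finset.sum_pos (fun i _ => mul_pos (hw i) (Real.exp_pos _)) Finset.univ_nonempty
  refine ⟨fun i => div_nonneg (mul_pos (hw i) (Real.exp_pos _)).le hZ0.le, ?_⟩
  rw [← Finset.sum_div, div_self hZ0.ne']

/-- The functions on `ι ⊕ κ` that are `1`-Lipschitz for `d` and vanish at `o`. -/
def lipVec (d : ι ⊕ κ → ι ⊕ κ → ℝ) (o : ι ⊕ κ) : Set (ι ⊕ κ → ℝ) :=
  {f | f o = 0 ∧ ∀ p q, f p - f q ≤ d p q}

omit [Fintype ι] [Fintype κ] in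
-- The normalization at `o` confines each coordinate to a bounded interval; this is its only
-- purpose.
theorem isCompact_lipVec (d : ι ⊕ κ → ι ⊕ κ → ℝ) (o : ι ⊕ κ) : IsCompact (lipVec d o) := by
  have hb : IsCompact (Set.pi Set.univ fun p => Set.Icc (-d o p) (d p o)) :=
    isCompact_univ_pi fun p => isCompact_Icc
  refine hb.of_isClosed_subset ?_ ?_
  · have : lipVec d o = {f | f o = 0} ∩ ⋂ p, ⋂ q, {f : ι ⊕ κ → ℝ | f p - f q ≤ d p q} := by
      ext f
      simp [lipVec]
    rw [this]
    refine (isClosed_eq (continuous_apply o) continuous_const).inter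
      (isClosed_iInter fun p => isClosed_iInter fun q => isClosed_le ?_ continuous_const)
    exact (continuous_apply p).sub (continuous_apply q)
  · intro f hf p _
    have h1 := hf.2 p o
    have h2 := hf.2 o p
    rw [hf.1] at h1 h2
    constructor <;> linarith

/-- The pairing `∑ j, m j f j - ∑ i, p i f i`. -/
def pairing (m : κ → ℝ) (p : ι → ℝ) (f : ι ⊕ κ → ℝ) : ℝ :=
  ∑ j, m j * f (.inr j) - ∑ i, p i * f (.inl i)

/-- The Lipschitz-dual transport cost between weights on `κ` and weights on `ι`. -/
noncomputable def discreteTransport (d : ι ⊕ κ → ι ⊕ κ → ℝ) (o : ι ⊕ κ) (m : κ → ℝ)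
    (p : ι → ℝ) : ℝ := sSup (pairing m p '' lipVec d o)

theorem continuous_pairing (m : κ → ℝ) :
    Continuous (Function.uncurry (pairing (ι := ι) m)) := by
  unfold Function.uncurry pairing
  fun_prop

/-- Both weight vectors have mass one, so normalizing at `o` does not change the transport cost. -/
theorem pairing_sub_const {m : κ → ℝ} {p : ι → ℝ} (hm : m ∈ stdSimplex ℝ κ)
    (hp : p ∈ stdSimplex ℝ ι) (f : ι ⊕ κ → ℝ) (a : ℝ) :
    pairing m p (fun q => f q - a) = pairing m p f := by
  simp only [pairing, mul_sub, Finset.sum_sub_distrib, ← Finset.sum_mul, hm.2, hp.2]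
  ring

theorem pairing_smul (m : κ → ℝ) (p : ι → ℝ) (f : ι ⊕ κ → ℝ) (t : ℝ) :
    pairing m p (fun q => t * f q) = t * pairing m p f := by
  simp only [pairing, mul_sub, Finset.mul_sum]
  congr 1 <;> exact Finset.sum_congr rfl fun _ _ => by ring

variable {d : ι ⊕ κ → ι ⊕ κ → ℝ} {o : ι ⊕ κ} {m : κ → ℝ}

theorem continuous_discreteTransport : Continuous (discreteTransport d o m) :=
  (isCompact_lipVec d o).continuous_sSup (continuous_pairing m)

theorem bddAbove_pairing (p : ι → ℝ) : BddAbove (pairing m p '' lipVec d o) := by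
  refine ((isCompact_lipVec d o).image ?_).bddAbove
  unfold pairing
  fun_prop

omit [Fintype ι] [Fintype κ] in
theorem zero_mem_lipVec (hd : ∀ p q, 0 ≤ d p q) : (0 : ι ⊕ κ → ℝ) ∈ lipVec d o :=
  ⟨rfl, fun p q => by simpa using hd p q⟩

theorem exists_pairing_eq (hd : ∀ p q, 0 ≤ d p q) (p : ι → ℝ) :
    ∃ f ∈ lipVec d o, pairing m p f = discreteTransport d o m p := by
  have hc : Continuous (pairing m p) := by
    unfold pairing
    fun_prop
  exact ((isCompact_lipVec d o).image hc).sSup_mem ⟨_, 0, zero_mem_lipVec hd, rfl⟩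

theorem pairing_le_discreteTransport (hm : m ∈ stdSimplex ℝ κ) {p : ι → ℝ}
    (hp : p ∈ stdSimplex ℝ ι) {f : ι ⊕ κ → ℝ} (hf : ∀ p q, f p - f q ≤ d p q) :
    pairing m p f ≤ discreteTransport d o m p := by
  rw [← pairing_sub_const hm hp f (f o)]
  refine le_csSup (bddAbove_pairing p) ⟨_, ⟨sub_self _, fun q r => ?_⟩, rfl⟩
  simpa using hf q r

/-- A supremum of functions affine in the weights is convex. -/
theorem discreteTransport_midpoint_le (hd : ∀ p q, 0 ≤ d p q) (p q : ι → ℝ) :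
    discreteTransport d o m ((1 / 2 : ℝ) • p + (1 / 2 : ℝ) • q) ≤
      1 / 2 * discreteTransport d o m p + 1 / 2 * discreteTransport d o m q := by
  obtain ⟨f, hf, hfe⟩ := exists_pairing_eq (o := o) (m := m) hd ((1 / 2 : ℝ) • p + (1 / 2 : ℝ) • q)
  rw [← hfe]
  have h1 : pairing m p f ≤ _ := le_csSup (bddAbove_pairing p) ⟨f, hf, rfl⟩
  have h2 : pairing m q f ≤ _ := le_csSup (bddAbove_pairing q) ⟨f, hf, rfl⟩
  have h3 : pairing m ((1 / 2 : ℝ) • p + (1 / 2 : ℝ) • q) f =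
      1 / 2 * pairing m p f + 1 / 2 * pairing m q f := by
    simp only [pairing, Pi.add_apply, Pi.smul_apply, smul_eq_mul, add_mul,
      Finset.sum_add_distrib, mul_assoc, ← Finset.mul_sum]
    ring
  rw [h3]
  unfold discreteTransport
  linarith

/-- Among the weights of minimal transport cost there is exactly one of minimal entropy. -/
theorem exists_unique_entropy_minimizer [Nonempty ι] (hd : ∀ p q, 0 ≤ d p q) {w : ι → ℝ}
    (hw : ∀ i, 0 < w i) :
    ∃ p ∈ stdSimplex ℝ ι,
      (∀ q ∈ stdSimplex ℝ ι, discreteTransport d o m p ≤ discreteTransport d o m q) ∧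
      (∀ q ∈ stdSimplex ℝ ι, discreteTransport d o m q ≤ discreteTransport d o m p →
        discreteEntropy w p ≤ discreteEntropy w q) ∧
      (∀ q ∈ stdSimplex ℝ ι, discreteTransport d o m q ≤ discreteTransport d o m p →
        discreteEntropy w q ≤ discreteEntropy w p → q = p) := by
  classical
  have hPc := isCompact_stdSimplex ℝ ι
  have hPn : (stdSimplex ℝ ι).Nonempty :=
    ⟨_, single_mem_stdSimplex ℝ (Classical.arbitrary ι)⟩
  have hVc := continuous_discreteTransport (d := d) (o := o) (m := m)
  obtain ⟨v, hv, hvmin⟩ := hPc.exists_isMinOn hPn hVc.continuousOn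
  obtain ⟨p, ⟨hp, hpv⟩, hpmin⟩ := (hPc.inter_right
    (isClosed_le hVc (continuous_const (y := discreteTransport d o m v)))).exists_isMinOn
    ⟨v, hv, le_refl (discreteTransport d o m v)⟩ (continuous_discreteEntropy hw).continuousOn
  simp only [Set.mem_ofPred_eq] at hpv
  refine ⟨p, hp, fun q hq => hpv.trans (hvmin hq), fun q hq hqp => hpmin ⟨hq, hqp.trans hpv⟩,
    fun q hq hqp hqR => ?_⟩
  by_contra hne
  -- The midpoint of two distinct minimizers would still have minimal transport cost, but strictly
  -- smaller entropy.
  have hr : (1 / 2 : ℝ) • p + (1 / 2 : ℝ) • q ∈ stdSimplex ℝ ι :=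
    convex_stdSimplex ℝ ι hp hq (by norm_num) (by norm_num) (by norm_num)
  have h1 := discreteTransport_midpoint_le (o := o) (m := m) hd p q
  have h2 := discreteEntropy_midpoint_lt hw hp hq (Ne.symm hne)
  have h3 : discreteEntropy w p ≤ _ :=
    hpmin ⟨hr, show discreteTransport d o m _ ≤ _ by linarith⟩
  linarith

/-- The objective of the `Γ`-divergence, scaled by `b`, on functions on a finite set. -/
noncomputable def discreteObjective (w : ι → ℝ) (m : κ → ℝ) (b : ℝ) (f : ι ⊕ κ → ℝ) : ℝ :=
  ∑ j, m j * (b * f (.inr j)) - Real.log (∑ i, w i * Real.exp (b * f (.inl i)))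

/-- Weak duality: adding and subtracting `∑ i, p i * (b * f (.inl i))` splits the objective into `b`
times a pairing and the left side of Gibbs' inequality. -/
theorem discreteObjective_le {w : ι → ℝ} (hw : ∀ i, 0 < w i) {b : ℝ} (hb : 0 < b)
    (hm : m ∈ stdSimplex ℝ κ) {p : ι → ℝ} (hp : p ∈ stdSimplex ℝ ι) {f : ι ⊕ κ → ℝ}
    (hf : ∀ p q, f p - f q ≤ d p q) :
    discreteObjective w m b f ≤ b * discreteTransport d o m p + discreteEntropy w p := by
  have h1 := mul_le_mul_of_nonneg_left (pairing_le_discreteTransport (o := o) hm hp hf) hb.le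
  have h2 := sum_mul_sub_log_sum_exp_le hw hp (fun i => b * f (.inl i))
  rw [← pairing_smul] at h1
  unfold pairing at h1
  unfold discreteObjective
  linarith

theorem continuous_discreteObjective {w : ι → ℝ} (hw : ∀ i, 0 < w i) [Nonempty ι] (b : ℝ) :
    Continuous (discreteObjective w m b) := by
  unfold discreteObjective
  refine Continuous.sub (by fun_prop) (Continuous.log (by fun_prop) fun f => ?_)
  exact (Finset.sum_pos (fun i _ => mul_pos (hw i) (Real.exp_pos _)) Finset.univ_nonempty).ne'

/-- Duality: the maximum of the objective over Lipschitz functions is attained, and it equals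
`b` times the transport cost plus the entropy of suitable weights. -/
theorem exists_discreteObjective_ge (hd : ∀ p q, 0 ≤ d p q) {w : ι → ℝ} (hw : ∀ i, 0 < w i)
    [Nonempty ι] {b : ℝ} (hb : 0 < b) :
    ∃ f ∈ lipVec d o, ∃ p ∈ stdSimplex ℝ ι,
      b * discreteTransport d o m p + discreteEntropy w p ≤ discreteObjective w m b f := by
  obtain ⟨g, hg, hgmax⟩ := (isCompact_lipVec d o).exists_isMaxOn ⟨0, zero_mem_lipVec hd⟩
    (continuous_discreteObjective (m := m) hw b).continuousOn
  refine ⟨g, hg, _, gibbs_mem_stdSimplex hw (fun i => b * g (.inl i)), ?_⟩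
  rw [discreteEntropy_gibbs hw]
  set Z := ∑ k, w k * Real.exp (b * g (.inl k)) with hZ
  have hZ0 : 0 < Z :=
    Finset.sum_pos (fun i _ => mul_pos (hw i) (Real.exp_pos _)) Finset.univ_nonempty
  set p : ι → ℝ := fun i => w i * Real.exp (b * g (.inl i)) / Z with hp
  obtain ⟨f, hf, hfe⟩ := exists_pairing_eq (o := o) (m := m) hd p
  -- First-order optimality of `g`: the segment from `g` to `f` stays in the convex set `lipVec d
  -- o`, and the derivative of the objective along it at `g` is `b` times the difference of the two
  -- pairings. Thus `g` is itself optimal for the transport cost at its Gibbs weights `p`.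
  have key : pairing m p f ≤ pairing m p g := by
    set φ : ℝ → ℝ := fun s => discreteObjective w m b (g + s • (f - g)) with hφ
    have hder : HasDerivAt φ (b * (pairing m p f - pairing m p g)) 0 := by
      have e1 : ∀ q, HasDerivAt (fun s : ℝ => b * (g + s • (f - g)) q) (b * (f q - g q)) 0 := by
        intro q
        have := (((hasDerivAt_id (0 : ℝ)).mul_const (f q - g q)).const_add (g q)).const_mul b
        simpa using! this
      have e2 : HasDerivAt (fun s : ℝ => ∑ j, m j * (b * (g + s • (f - g)) (.inr j)))
          (∑ j, m j * (b * (f (.inr j) - g (.inr j)))) 0 :=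
        HasDerivAt.fun_sum fun j _ => (e1 _).const_mul _
      have e3 : HasDerivAt (fun s : ℝ => ∑ i, w i * Real.exp (b * (g + s • (f - g)) (.inl i)))
          (∑ i, w i * (Real.exp (b * g (.inl i)) * (b * (f (.inl i) - g (.inl i))))) 0 :=
        HasDerivAt.fun_sum fun i _ => by
          have := ((e1 (.inl i)).exp).const_mul (w i)
          simpa using! this
      have e4 := e2.sub (e3.log (by simpa using! hZ0.ne'))
      refine e4.congr_deriv ?_
      simp only [zero_smul, add_zero, ← hZ]
      have : (∑ i, w i * (Real.exp (b * g (.inl i)) * (b * (f (.inl i) - g (.inl i))))) / Z =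
          b * ∑ i, p i * f (.inl i) - b * ∑ i, p i * g (.inl i) := by
        rw [Finset.sum_div, Finset.mul_sum, Finset.mul_sum, ← Finset.sum_sub_distrib]
        refine Finset.sum_congr rfl fun i _ => ?_
        simp only [hp]
        field_simp
      rw [this]
      simp only [pairing, mul_sub, Finset.mul_sum, Finset.sum_sub_distrib]
      have (h : ι ⊕ κ → ℝ) : ∑ j, m j * (b * h (.inr j)) = ∑ j, b * (m j * h (.inr j)) :=
        Finset.sum_congr rfl fun _ _ => by ring
      rw [this f, this g]
      ring
    have hle : ∀ s ∈ Set.Ioc (0 : ℝ) 1, φ s ≤ φ 0 := by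
      intro s hs
      have : g + s • (f - g) ∈ lipVec d o := by
        refine ⟨by simp [hf.1, hg.1], fun q r => ?_⟩
        have h1 := mul_le_mul_of_nonneg_left (hf.2 q r) hs.1.le
        have h2 := mul_le_mul_of_nonneg_left (hg.2 q r) (sub_nonneg.2 hs.2)
        simp only [Pi.add_apply, Pi.smul_apply, Pi.sub_apply, smul_eq_mul]
        linarith
      simpa [hφ] using! hgmax this
    have hslope := hder.hasDerivWithinAt (s := Set.Ioi 0)
    rw [hasDerivWithinAt_iff_tendsto_slope' (by simp)] at hslope
    have h0 : b * (pairing m p f - pairing m p g) ≤ 0 := by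
      refine le_of_tendsto hslope ?_
      filter_upwards [Ioc_mem_nhdsGT (zero_lt_one' ℝ)] with s hs
      rw [slope_def_field, sub_zero]
      exact div_nonpos_of_nonpos_of_nonneg (sub_nonpos.2 (hle s hs)) hs.1.le
    nlinarith
  rw [← hfe]
  have h1 := mul_le_mul_of_nonneg_left key hb.le
  rw [← pairing_smul (f := g)] at h1
  simp only [pairing, hp] at h1
  simp only [discreteObjective, pairing, ← hZ, hp]
  linarith

/-- If every `j` has a strictly closest point `n j`, then weights of minimal transport cost are
the image of `m` under `n`. -/
theorem eq_sum_of_discreteTransport_le [DecidableEq ι] [Nonempty ι]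
    (hd : ∀ p q, 0 ≤ d p q) (hdd : ∀ p, d p p = 0)
    (htri : ∀ p q r, d p r ≤ d p q + d q r) (hm : m ∈ stdSimplex ℝ κ) {p : ι → ℝ}
    (hp : p ∈ stdSimplex ℝ ι)
    (hmin : ∀ q ∈ stdSimplex ℝ ι, discreteTransport d o m p ≤ discreteTransport d o m q)
    (n : κ → ι) (hn : ∀ j i, i ≠ n j → d (.inr j) (.inl (n j)) < d (.inr j) (.inl i)) (i : ι) :
    p i = ∑ j with n j = i, m j := by
  set q : ι → ℝ := fun i => ∑ j with n j = i, m j with hq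
  have hsum (h : ι → ℝ) : ∑ i, q i * h i = ∑ j, m j * h (n j) := by
    simp only [hq, Finset.sum_mul]
    rw [← Finset.sum_fiberwise (s := Finset.univ) n (fun j => m j * h (n j))]
    refine Finset.sum_congr rfl fun i _ => Finset.sum_congr rfl fun j hj => ?_
    rw [(Finset.mem_filter.1 hj).2]
  have hqs : q ∈ stdSimplex ℝ ι := by
    refine ⟨fun i => Finset.sum_nonneg fun j _ => hm.1 j, ?_⟩
    have := hsum 1
    simpa [hm.2] using this
  have hVq : discreteTransport d o m q ≤ ∑ j, m j * d (.inr j) (.inl (n j)) := by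
    obtain ⟨f, hf, hfe⟩ := exists_pairing_eq (o := o) (m := m) hd q
    rw [← hfe, pairing, hsum (fun i => f (.inl i)), ← Finset.sum_sub_distrib]
    refine Finset.sum_le_sum fun j _ => ?_
    have := mul_le_mul_of_nonneg_left (hf.2 (.inr j) (.inl (n j))) (hm.1 j)
    linarith
  -- perturb the distance to the set of all `inl i`
  have hpert : ∀ η : ι → ℝ,
      (∀ j i, d (.inr j) (.inl (n j)) + η (n j) ≤ d (.inr j) (.inl i) + η i) →
      ∑ i, η i * (q i - p i) ≤ 0 := by
    intro η hη
    set f : ι ⊕ κ → ℝ := fun r =>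
      Finset.univ.inf' Finset.univ_nonempty fun i => d r (.inl i) + η i with hf
    have hfl : ∀ r s, f r - f s ≤ d r s := by
      intro r s
      obtain ⟨i, -, hi⟩ := Finset.exists_mem_eq_inf' Finset.univ_nonempty
        fun i => d s (.inl i) + η i
      have h1 : f r ≤ d r (.inl i) + η i := Finset.inf'_le _ (Finset.mem_univ i)
      have h2 : f s = d s (.inl i) + η i := hi
      have := htri r s (.inl i)
      linarith
    -- By minimality of `p`, the pairing of `f` with `p` is at most the cost of sending each `j` to
    -- `n j`. By `h2` and `h3` it is at least that cost plus `∑ i, η i * (q i - p i)`, so this sum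
    -- is nonpositive.
    have h1 := (pairing_le_discreteTransport (o := o) hm hp hfl).trans ((hmin q hqs).trans hVq)
    have h2 : ∑ i, p i * f (.inl i) ≤ ∑ i, p i * η i := by
      refine Finset.sum_le_sum fun i _ => mul_le_mul_of_nonneg_left ?_ (hp.1 i)
      have : f (.inl i) ≤ d (.inl i) (.inl i) + η i := Finset.inf'_le _ (Finset.mem_univ i)
      simpa [hdd] using this
    have h3 : ∑ j, m j * (d (.inr j) (.inl (n j)) + η (n j)) ≤ ∑ j, m j * f (.inr j) := by
      refine Finset.sum_le_sum fun j _ => mul_le_mul_of_nonneg_left ?_ (hm.1 j)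
      exact Finset.le_inf' _ _ fun i _ => hη j i
    simp only [mul_add, Finset.sum_add_distrib] at h3
    rw [← hsum] at h3
    unfold pairing at h1
    have h4 : ∑ i, η i * (q i - p i) = ∑ i, q i * η i - ∑ i, p i * η i := by
      rw [← Finset.sum_sub_distrib]
      exact Finset.sum_congr rfl fun _ _ => by ring
    linarith
  -- The strict gaps in `hn` survive a small perturbation, so `η = t • (q - p)` is admissible for
  -- some `t > 0`; it yields `t * ∑ i, (q i - p i) ^ 2 ≤ 0`.
  have hsmall : ∀ᶠ t : ℝ in 𝓝[>] 0, ∀ j i,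
      d (.inr j) (.inl (n j)) + t * (q (n j) - p (n j)) ≤
        d (.inr j) (.inl i) + t * (q i - p i) := by
    rw [eventually_all]
    intro j
    rw [eventually_all]
    intro i
    by_cases h : i = n j
    · subst h
      exact Eventually.of_forall fun t => le_rfl
    · have hc : ∀ a e : ℝ, Tendsto (fun t : ℝ => a + t * e) (𝓝[>] 0) (𝓝 (a + 0 * e)) :=
        fun a e => ((by fun_prop : Continuous fun t : ℝ => a + t * e).tendsto 0).mono_left
          nhdsWithin_le_nhds
      refine (Tendsto.eventually_lt (hc _ _) (hc _ _) ?_).mono fun t ht => ht.le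
      simpa using hn j i h
  obtain ⟨t, ht, ht0⟩ := (hsmall.and self_mem_nhdsWithin).exists
  have h1 := hpert (fun i => t * (q i - p i)) ht
  have h2 : ∑ i, t * (q i - p i) * (q i - p i) = t * ∑ i, (q i - p i) ^ 2 := by
    rw [Finset.mul_sum]
    exact Finset.sum_congr rfl fun _ _ => by ring
  rw [h2] at h1
  have h3 : ∑ i, (q i - p i) ^ 2 = 0 :=
    le_antisymm (nonpos_of_mul_nonpos_right h1 ht0) (Finset.sum_nonneg fun _ _ => sq_nonneg _)
  have h4 := (Finset.sum_eq_zero_iff_of_nonneg fun _ _ => sq_nonneg _).1 h3 i (Finset.mem_univ i)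
  have := pow_eq_zero_iff (two_ne_zero) |>.1 h4
  show p i = q i
  linarith

end Discrete

/-! ### Finitely supported probability measures -/

section FiniteSupport

variable {S : Type*} [MeasurableSpace S] {ι : Type*} [Fintype ι] {x : ι → S}

/-- The masses of the points `x i`. -/
noncomputable def weights (x : ι → S) (γ : ProbabilityMeasure S) (i : ι) : ℝ :=
  (γ : Measure S).real {x i}

omit [Fintype ι] in
theorem measure_compl_range_eq_zero [TopologicalSpace S] [HereditarilyLindelofSpace S]
    {ν : Measure S} (h : Set.range x = ν.support) : ν (Set.range x)ᶜ = 0 := by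
  rw [h]
  exact Measure.measure_compl_support

/-- Removing the finitely many other support points leaves an open neighbourhood of `x i`. It has
positive mass, and all of that mass sits at `x i`. -/
theorem measureReal_singleton_pos [TopologicalSpace S] [T1Space S]
    [HereditarilyLindelofSpace S] {ν : Measure S} [IsFiniteMeasure ν]
    (h : Set.range x = ν.support) (i : ι) : 0 < ν.real {x i} := by
  have hi : x i ∈ ν.support := h ▸ Set.mem_range_self i
  rw [Measure.mem_support_iff_forall] at hi
  have hF : (Set.range x \ {x i}).Finite := (Set.finite_range x).sdiff
  have hU := hi _ (hF.isClosed.isOpen_compl.mem_nhds (by simp))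
  have hle : ν (Set.range x \ {x i})ᶜ ≤ ν {x i} + ν (Set.range x)ᶜ := by
    refine (measure_mono fun s hs => ?_).trans (measure_union_le _ _)
    by_cases hsr : s ∈ Set.range x
    · left
      by_contra hne
      exact hs ⟨hsr, hne⟩
    · exact Or.inr hsr
  rw [measure_compl_range_eq_zero h, add_zero] at hle
  exact ENNReal.toReal_pos (hU.trans_le hle).ne' (measure_ne_top _ _)

variable [MeasurableSingletonClass S]

theorem integrable_of_measure_compl_range (γ : Measure S) [IsFiniteMeasure γ]
    (h : γ (Set.range x)ᶜ = 0) (g : S → ℝ) : Integrable g γ := by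
  classical
  have h1 : γ.restrict ↑(Finset.univ.image x) = γ := by
    refine Measure.restrict_eq_self_of_ae_mem (measure_mono_null (fun s hs => ?_) h)
    simpa using hs
  rw [← h1]
  exact IntegrableOn.finset

theorem integral_eq_sum_of_measure_compl_range (hx : Function.Injective x) (γ : Measure S)
    [IsFiniteMeasure γ] (h : γ (Set.range x)ᶜ = 0) (g : S → ℝ) :
    ∫ s, g s ∂γ = ∑ i, γ.real {x i} * g (x i) := by
  classical
  have h1 : γ.restrict ↑(Finset.univ.image x) = γ := by
    refine Measure.restrict_eq_self_of_ae_mem (measure_mono_null (fun s hs => ?_) h)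
    simpa using hs
  have h2 := setIntegral_finset (μ := γ) (f := g) (Finset.univ.image x) IntegrableOn.finset
  rw [h1, Finset.sum_image fun a _ b _ hab => hx hab] at h2
  simpa using h2

theorem weights_mem_stdSimplex (hx : Function.Injective x) (γ : ProbabilityMeasure S)
    (h : (γ : Measure S) (Set.range x)ᶜ = 0) : weights x γ ∈ stdSimplex ℝ ι := by
  refine ⟨fun i => measureReal_nonneg, ?_⟩
  have := integral_eq_sum_of_measure_compl_range hx (γ : Measure S) h fun _ => 1
  simpa [weights] using this.symm

theorem eq_of_weights_eq (hx : Function.Injective x) {γ γ' : ProbabilityMeasure S}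
    (h : (γ : Measure S) (Set.range x)ᶜ = 0) (h' : (γ' : Measure S) (Set.range x)ᶜ = 0)
    (hw : weights x γ = weights x γ') : γ = γ' := by
  refine Subtype.ext (?_ : (γ : Measure S) = (γ' : Measure S))
  refine Measure.ext fun s hs => ?_
  rw [← measureReal_eq_measureReal_iff, ← integral_indicator_one hs, ← integral_indicator_one hs,
    integral_eq_sum_of_measure_compl_range hx _ h, integral_eq_sum_of_measure_compl_range hx _ h']
  exact Finset.sum_congr rfl fun i _ => congrArg (· * _) (congrFun hw i)

theorem exists_weights_eq (hx : Function.Injective x) {p : ι → ℝ} (hp : p ∈ stdSimplex ℝ ι)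
    {ν : Measure S} (hν : ∀ i, 0 < ν.real {x i}) :
    ∃ γ : ProbabilityMeasure S, (γ : Measure S) ≪ ν ∧ weights x γ = p := by
  classical
  set m : Measure S := ∑ i, ENNReal.ofReal (p i) • Measure.dirac (x i) with hm
  have happ : ∀ s, MeasurableSet s → m s = ∑ i, ENNReal.ofReal (p i) * s.indicator 1 (x i) := by
    intro s hs
    simp [hm, Measure.dirac_apply' _ hs]
  have hprob : IsProbabilityMeasure m := by
    refine ⟨?_⟩
    rw [happ _ MeasurableSet.univ]
    simp only [Set.indicator_univ, Pi.one_apply, mul_one]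
    rw [← ENNReal.ofReal_sum_of_nonneg fun i _ => hp.1 i, hp.2, ENNReal.ofReal_one]
  refine ⟨⟨m, hprob⟩, ?_, ?_⟩
  · refine Measure.AbsolutelyContinuous.mk fun s hs hs0 => ?_
    show m s = 0
    rw [happ s hs]
    refine Finset.sum_eq_zero fun i _ => ?_
    have : x i ∉ s := fun hi => by
      have h0 := measure_mono_null (Set.singleton_subset_iff.2 hi) hs0
      have := hν i
      simp [Measure.real, h0] at this
    simp [this]
  · ext i
    show m.real {x i} = p i
    rw [Measure.real, happ _ (measurableSet_singleton _)]
    rw [Finset.sum_eq_single i]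
    · simp [hp.1 i]
    · intro k _ hk
      simp [hx.ne hk]
    · simp

/-- At an atom of `ν` the density is the ratio of masses. The mass correction in `klDiv` cancels for
probability measures, and nonnegativity of the integral makes the truncation by `ENNReal.ofReal`
harmless. -/
theorem relEntropy_eq_discreteEntropy (hx : Function.Injective x) {γ ν : ProbabilityMeasure S}
    (h : (ν : Measure S) (Set.range x)ᶜ = 0) (hν : ∀ i, 0 < weights x ν i)
    (hγ : (γ : Measure S) ≪ (ν : Measure S)) :
    relEntropy γ ν = (discreteEntropy (weights x ν) (weights x γ) : EReal) := by
  have hint := integrable_of_measure_compl_range (γ : Measure S) (hγ h)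
    (llr (γ : Measure S) (ν : Measure S))
  have hE : ∫ s, llr (γ : Measure S) (ν : Measure S) s ∂(γ : Measure S) =
      discreteEntropy (weights x ν) (weights x γ) := by
    rw [integral_eq_sum_of_measure_compl_range hx _ (hγ h)]
    refine Finset.sum_congr rfl fun i _ => ?_
    have h1 := Measure.setLIntegral_rnDeriv hγ {x i}
    rw [lintegral_singleton] at h1
    have h2 := congrArg ENNReal.toReal h1
    rw [ENNReal.toReal_mul] at h2
    have h3 : ((γ : Measure S).rnDeriv (ν : Measure S) (x i)).toReal =
        weights x γ i / weights x ν i := by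
      rw [eq_div_iff (hν i).ne']
      exact h2
    rw [llr, h3, weights]
  have hnn := integral_llr_add_sub_measure_univ_nonneg hγ hint
  rw [relEntropy, klDiv_of_ac_of_integrable hγ hint]
  simp only [probReal_univ, add_sub_cancel_right, hE] at hnn ⊢
  rw [EReal.coe_ennreal_ofReal, max_eq_left hnn]

theorem absolutelyContinuous_of_relEntropy_ne_top {S : Type*} [MeasurableSpace S]
    {γ ν : ProbabilityMeasure S} (h : relEntropy γ ν ≠ ⊤) :
    (γ : Measure S) ≪ (ν : Measure S) := by
  by_contra hac
  exact h (by simp [relEntropy, klDiv_of_not_ac hac])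

end FiniteSupport

/-! ### Extension of Lipschitz functions from finite sets -/

section Extension

variable {S : Type*} [TopologicalSpace S] {c : S → S → ℝ≥0∞}

theorem cost_self (hrep : CostRepresentation c) (s : S) : c s s = 0 := by
  obtain ⟨Q, hQ, h⟩ := hrep
  have h1 : (c s s : EReal) ≤ 0 := by
    rw [h]
    exact iSup₂_le fun u _ => by simp
  exact le_antisymm (by exact_mod_cast h1) bot_le

theorem cost_triangle (hrep : CostRepresentation c) (s t r : S) : c s r ≤ c s t + c t r := by
  obtain ⟨Q, hQ, h⟩ := hrep
  have h1 : (c s r : EReal) ≤ (c s t : EReal) + (c t r : EReal) := by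
    rw [h s r]
    refine iSup₂_le fun u hu => ?_
    have e1 : ((u s - u t : ℝ) : EReal) ≤ c s t := by
      rw [h]
      exact le_iSup₂ (f := fun (u : S →ᵇ ℝ) (_ : u ∈ Q) => ((u s - u t : ℝ) : EReal)) u hu
    have e2 : ((u t - u r : ℝ) : EReal) ≤ c t r := by
      rw [h]
      exact le_iSup₂ (f := fun (u : S →ᵇ ℝ) (_ : u ∈ Q) => ((u t - u r : ℝ) : EReal)) u hu
    refine le_trans (le_of_eq ?_) (add_le_add e1 e2)
    rw [← EReal.coe_add]
    congr 1
    ring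
  exact_mod_cast h1

variable (hfin : ∀ s t, c s t ≠ ∞)

include hfin in
theorem mem_lipCb_iff {f : S →ᵇ ℝ} :
    f ∈ lipCb c ↔ ∀ s t, f s - f t ≤ (c s t).toReal := by
  refine forall₂_congr fun s t => ?_
  rw [← EReal.coe_ennreal_toReal (hfin s t), EReal.coe_le_coe_iff]

include hfin in
-- Every member of `Q` lies in `lipCb c`. The inequality is strict because the supremum need not be
-- attained; this is the source of the factors `k < 1` later on.
theorem exists_lt_sub_of_costRepresentation (hrep : CostRepresentation c) {s t : S} {a : ℝ}
    (ha : a < (c s t).toReal) : ∃ u ∈ lipCb c, a < u s - u t := by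
  obtain ⟨Q, hQ, h⟩ := hrep
  have h1 : (a : EReal) < c s t := by
    rw [← EReal.coe_ennreal_toReal (hfin s t)]
    exact_mod_cast ha
  rw [h, lt_iSup_iff] at h1
  obtain ⟨u, hu⟩ := h1
  rw [lt_iSup_iff] at hu
  obtain ⟨huQ, hu⟩ := hu
  refine ⟨u, fun s t => ?_, by exact_mod_cast hu⟩
  rw [h]
  exact le_iSup₂ (f := fun (u : S →ᵇ ℝ) (_ : u ∈ Q) => ((u s - u t : ℝ) : EReal)) u huQ

include hfin in
/-- Two-point interpolation by a Lipschitz function. -/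
theorem exists_mem_lipCb_two_values (hrep : CostRepresentation c) {s t : S} {a b : ℝ}
    (h : a - b < (c s t).toReal ∨ a = b) (h' : b - a < (c t s).toReal ∨ a = b) :
    ∃ g ∈ lipCb c, g s = a ∧ g t = b := by
  have aux : ∀ {s t : S} {a b : ℝ}, b < a → a - b < (c s t).toReal →
      ∃ g ∈ lipCb c, g s = a ∧ g t = b := by
    intro s t a b hab hlt
    obtain ⟨u, hu, hlu⟩ := exists_lt_sub_of_costRepresentation hfin hrep hlt
    have hpos : 0 < u s - u t := by linarith
    set k : ℝ := (a - b) / (u s - u t) with hk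
    have hk0 : 0 ≤ k := div_nonneg (by linarith) hpos.le
    have hk1 : k ≤ 1 := (div_le_one hpos).2 hlu.le
    have hkm : k * (u s - u t) = a - b := div_mul_cancel₀ _ hpos.ne'
    -- Shrinking `u` by `k ≤ 1` keeps it Lipschitz and makes its increment exactly `a - b`; the
    -- constant then fixes the value at `t`.
    refine ⟨k • u + BoundedContinuousFunction.const S (b - k * u t), ?_, ?_, ?_⟩
    · rw [mem_lipCb_iff hfin] at hu ⊢
      intro r q
      have h1 := mul_le_mul_of_nonneg_left (hu r q) hk0
      have h2 := mul_le_mul_of_nonneg_right hk1 (c r q).toReal_nonneg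
      simp
      linarith
    · simp
      linarith
    · simp
  rcases lt_trichotomy a b with hab | hab | hab
  · obtain ⟨g, hg, h1, h2⟩ := aux hab (h'.resolve_right hab.ne)
    exact ⟨g, hg, h2, h1⟩
  · refine ⟨BoundedContinuousFunction.const S a, ?_, rfl, hab⟩
    rw [mem_lipCb_iff hfin]
    intro r q
    simp
  · exact aux hab (h.resolve_right hab.ne')

include hfin in
theorem inf_mem_lipCb {f g : S →ᵇ ℝ} (hf : f ∈ lipCb c) (hg : g ∈ lipCb c) :
    f ⊓ g ∈ lipCb c := by
  rw [mem_lipCb_iff hfin] at *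
  intro s t
  simp only [BoundedContinuousFunction.coe_inf, Pi.inf_apply]
  rcases le_total (f t) (g t) with h | h
  · rw [min_eq_left h]
    linarith [hf s t, min_le_left (f s) (g s)]
  · rw [min_eq_right h]
    linarith [hg s t, min_le_right (f s) (g s)]

include hfin in
theorem sup_mem_lipCb {f g : S →ᵇ ℝ} (hf : f ∈ lipCb c) (hg : g ∈ lipCb c) :
    f ⊔ g ∈ lipCb c := by
  rw [mem_lipCb_iff hfin] at *
  intro s t
  simp only [BoundedContinuousFunction.coe_sup, Pi.sup_apply]
  rcases le_total (f s) (g s) with h | h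
  · rw [max_eq_right h]
    linarith [hg s t, le_max_right (f t) (g t)]
  · rw [max_eq_left h]
    linarith [hf s t, le_max_left (f t) (g t)]

include hfin in
/-- A function on a finite family of points that is `k`-Lipschitz for the cost with `k < 1` is
the restriction of a bounded continuous Lipschitz function. -/
theorem exists_mem_lipCb_extension (hrep : CostRepresentation c) {α : Type*} [Fintype α]
    [Nonempty α] (z : α → S) {f : α → ℝ} (hf : ∀ p q, f p - f q ≤ (c (z p) (z q)).toReal)
    {k : ℝ} (hk0 : 0 ≤ k) (hk1 : k < 1) : ∃ F ∈ lipCb c, ∀ p, F (z p) = k * f p := by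
  -- A positive increment becomes strictly smaller than the cost after multiplication by `k < 1`.
  -- Equality of values must be allowed, since the cost may vanish.
  have hlt : ∀ p q, k * f p - k * f q < (c (z p) (z q)).toReal ∨ k * f p = k * f q := by
    intro p q
    have h0 := (c (z p) (z q)).toReal_nonneg
    rcases le_or_gt (f p) (f q) with h | h
    · have h1 := mul_le_mul_of_nonneg_left h hk0
      rcases h0.eq_or_lt with h2 | h2
      · rcases h1.eq_or_lt with h3 | h3
        · exact Or.inr h3
        · exact Or.inl (by linarith)
      · exact Or.inl (by linarith)
    · left
      have h1 : k * (f p - f q) < 1 * (f p - f q) :=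
        mul_lt_mul_of_pos_right hk1 (by linarith)
      linarith [hf p q]
  have hg : ∀ p q, ∃ g ∈ lipCb c, g (z p) = k * f p ∧ g (z q) = k * f q := fun p q =>
    exists_mem_lipCb_two_values hfin hrep (hlt p q) ((hlt q p).imp_right Eq.symm)
  choose g hgm hgp hgq using hg
  have hne := Finset.univ_nonempty (α := α)
  -- Lattice interpolation: `H p` has the prescribed value at `z p` and lies below the prescribed
  -- values at all other points, so the maximum of the `H p` interpolates everywhere.
  set H : α → S →ᵇ ℝ := fun p => Finset.univ.inf' hne (g p) with hH
  have hHm : ∀ p, H p ∈ lipCb c := fun p =>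
    Finset.inf'_mem _ (fun _ h _ h' => inf_mem_lipCb hfin h h') _ _ _ fun q _ => hgm p q
  have hHle : ∀ p q, H p (z q) ≤ k * f q := fun p q => by
    have : H p ≤ g p q := Finset.inf'_le _ (Finset.mem_univ q)
    exact (this (z q)).trans_eq (hgq p q)
  have hHp : ∀ p, k * f p ≤ H p (z p) := fun p => by
    refine Finset.inf'_induction (p := fun h : S →ᵇ ℝ => k * f p ≤ h (z p)) hne _
      (fun a ha b hb => le_min ha hb) fun q _ => (hgp p q).ge
  refine ⟨Finset.univ.sup' hne H,
    Finset.sup'_mem _ (fun _ h _ h' => sup_mem_lipCb hfin h h') _ _ _ fun p _ => hHm p,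
    fun q => le_antisymm ?_ ?_⟩
  · exact Finset.sup'_induction (p := fun h : S →ᵇ ℝ => h (z q) ≤ k * f q) hne _
      (fun a ha b hb => max_le ha hb) fun p _ => hHle p q
  · have : H q ≤ Finset.univ.sup' hne H := Finset.le_sup' _ (Finset.mem_univ q)
    exact (hHp q).trans (this (z q))

end Extension

/-! ### Reduction to finite sets -/

section Reduction

variable {S : Type*} [TopologicalSpace S] [MeasurableSpace S] [MeasurableSingletonClass S]
  {c : S → S → ℝ≥0∞} {ι κ : Type*} [Fintype ι] [Fintype κ] {x : ι → S} {y : κ → S}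

/-- The cost between the points of two families. -/
noncomputable def costMatrix {S ι κ : Type*} (c : S → S → ℝ≥0∞) (x : ι → S) (y : κ → S)
    (p q : ι ⊕ κ) : ℝ :=
  (c (Sum.elim x y p) (Sum.elim x y q)).toReal

/-- Restriction to the points gives `≤`. For `≥`, an optimal vector `f` need not extend, but `k • f`
does for `k < 1`, and the pairing is continuous as `k → 1`. -/
theorem gammaTransport_eq_discreteTransport (hfin : ∀ s t, c s t ≠ ∞)
    (hrep : CostRepresentation c) (hx : Function.Injective x) (hy : Function.Injective y)
    (o : ι ⊕ κ) {μ γ : ProbabilityMeasure S} (hμ : (μ : Measure S) (Set.range y)ᶜ = 0)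
    (hγ : (γ : Measure S) (Set.range x)ᶜ = 0) :
    gammaTransport (lipCb c) μ γ =
      (discreteTransport (costMatrix c x y) o (weights y μ) (weights x γ) : EReal) := by
  have hm := weights_mem_stdSimplex hy μ hμ
  have hp := weights_mem_stdSimplex hx γ hγ
  have hval : ∀ F : S →ᵇ ℝ, ∫ s, F s ∂(μ : Measure S) - ∫ s, F s ∂(γ : Measure S) =
      pairing (weights y μ) (weights x γ) fun r => F (Sum.elim x y r) := fun F => by
    rw [integral_eq_sum_of_measure_compl_range hy _ hμ,
      integral_eq_sum_of_measure_compl_range hx _ hγ]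
    rfl
  apply le_antisymm
  · refine iSup₂_le fun F hF => ?_
    rw [hval, EReal.coe_le_coe_iff]
    exact pairing_le_discreteTransport hm hp fun p q => (mem_lipCb_iff hfin).1 hF _ _
  · obtain ⟨f, hf, hfe⟩ := exists_pairing_eq (d := costMatrix c x y) (o := o)
      (m := weights y μ) (fun _ _ => ENNReal.toReal_nonneg) (weights x γ)
    rw [← hfe]
    have : Nonempty (ι ⊕ κ) := ⟨o⟩
    have hlim : Tendsto (fun k : ℝ => ((k * pairing (weights y μ) (weights x γ) f : ℝ) : EReal))
        (𝓝[<] 1) (𝓝 ((1 * pairing (weights y μ) (weights x γ) f : ℝ) : EReal)) := by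
      refine EReal.tendsto_coe.2 (Tendsto.mono_left ?_ nhdsWithin_le_nhds)
      exact (continuous_id.mul continuous_const).tendsto (1 : ℝ)
    rw [one_mul] at hlim
    refine le_of_tendsto hlim ?_
    filter_upwards [Ico_mem_nhdsLT (zero_lt_one' ℝ)] with k hk
    obtain ⟨F, hF, hFe⟩ :=
      exists_mem_lipCb_extension hfin hrep (Sum.elim x y) (f := f) hf.2 hk.1 hk.2
    rw [← pairing_smul, ← funext hFe, ← hval]
    exact le_iSup₂ (f := fun (g : S →ᵇ ℝ) (_ : g ∈ lipCb c) =>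
      ((∫ s, g s ∂(μ : Measure S) - ∫ s, g s ∂(γ : Measure S) : ℝ) : EReal)) F hF

theorem objective_eq_discreteObjective (hx : Function.Injective x) (hy : Function.Injective y)
    {μ ν : ProbabilityMeasure S} (hμ : (μ : Measure S) (Set.range y)ᶜ = 0)
    (hν : (ν : Measure S) (Set.range x)ᶜ = 0) (b : ℝ) (F : S →ᵇ ℝ) :
    ∫ s, (b • F) s ∂(μ : Measure S) - Real.log (∫ s, Real.exp ((b • F) s) ∂(ν : Measure S)) =
      discreteObjective (weights x ν) (weights y μ) b fun r => F (Sum.elim x y r) := by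
  rw [integral_eq_sum_of_measure_compl_range hy _ hμ,
    integral_eq_sum_of_measure_compl_range hx _ hν]
  rfl

theorem gammaDivergence_le (hfin : ∀ s t, c s t ≠ ∞)
    (hx : Function.Injective x) (hy : Function.Injective y) {o : ι ⊕ κ}
    {μ ν : ProbabilityMeasure S} (hμ : (μ : Measure S) (Set.range y)ᶜ = 0)
    (hν : (ν : Measure S) (Set.range x)ᶜ = 0) (hw : ∀ i, 0 < weights x ν i) {b : ℝ} (hb : 0 < b)
    {p : ι → ℝ} (hp : p ∈ stdSimplex ℝ ι) :
    gammaDivergence (b • lipCb c) μ ν ≤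
      ((b * discreteTransport (costMatrix c x y) o (weights y μ) p +
        discreteEntropy (weights x ν) p : ℝ) : EReal) := by
  refine iSup₂_le fun G hG => ?_
  obtain ⟨F, hF, rfl⟩ := Set.mem_smul_set.1 hG
  rw [objective_eq_discreteObjective hx hy hμ hν, EReal.coe_le_coe_iff]
  exact discreteObjective_le hw hb (weights_mem_stdSimplex hy μ hμ) hp
    fun p q => (mem_lipCb_iff hfin).1 hF _ _

/-- Here too `k • f` is extended for `k < 1`, and continuity of the objective allows `k → 1`. -/
theorem discreteObjective_le_gammaDivergence (hfin : ∀ s t, c s t ≠ ∞)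
    (hrep : CostRepresentation c) [Nonempty ι] (hx : Function.Injective x)
    (hy : Function.Injective y)
    {μ ν : ProbabilityMeasure S} (hμ : (μ : Measure S) (Set.range y)ᶜ = 0)
    (hν : (ν : Measure S) (Set.range x)ᶜ = 0) (hw : ∀ i, 0 < weights x ν i) (b : ℝ)
    {f : ι ⊕ κ → ℝ} (hf : ∀ p q, f p - f q ≤ costMatrix c x y p q) :
    (discreteObjective (weights x ν) (weights y μ) b f : EReal) ≤
      gammaDivergence (b • lipCb c) μ ν := by
  have hlim : Tendsto
      (fun k : ℝ => (discreteObjective (weights x ν) (weights y μ) b (k • f) : EReal))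
      (𝓝[<] 1) (𝓝 (discreteObjective (weights x ν) (weights y μ) b ((1 : ℝ) • f) : EReal)) := by
    refine EReal.tendsto_coe.2 (Tendsto.mono_left ?_ nhdsWithin_le_nhds)
    exact ((continuous_discreteObjective hw b).comp
      (continuous_id.smul continuous_const)).tendsto (1 : ℝ)
  rw [one_smul] at hlim
  refine le_of_tendsto hlim ?_
  filter_upwards [Ico_mem_nhdsLT (zero_lt_one' ℝ)] with k hk
  obtain ⟨F, hF, hFe⟩ := exists_mem_lipCb_extension hfin hrep (Sum.elim x y) hf hk.1 hk.2
  have : k • f = fun r => F (Sum.elim x y r) := (funext hFe).symm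
  rw [this, ← objective_eq_discreteObjective hx hy hμ hν]
  exact le_iSup₂ (f := fun (g : S →ᵇ ℝ) (_ : g ∈ b • lipCb c) =>
    ((∫ s, g s ∂(μ : Measure S) - Real.log (∫ s, Real.exp (g s) ∂(ν : Measure S)) : ℝ) : EReal))
    (b • F) (Set.smul_mem_smul_set hF)

end Reduction

/-! ### The expansion, its uniqueness and the nearest-point formula. -/

theorem mainTheorem9 {S : Type*} [TopologicalSpace S] [PolishSpace S]
    [MeasurableSpace S] [BorelSpace S]
    (c : S → S → ℝ≥0∞) (hsymm : ∀ s t : S, c s t = c t s)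
    (hrep : CostRepresentation c)
    (hdet : MeasureDetermining (lipCb c))
    (hfin : ∃ a : S → NNReal, ∀ s t : S, c s t ≤ (a s : ℝ≥0∞) + (a t : ℝ≥0∞))
    (μ ν : ProbabilityMeasure S)
    {N M : ℕ} (x : Fin N → S) (y : Fin M → S)
    (hx : Function.Injective x) (hy : Function.Injective y)
    (hxν : Set.range x = (ν : Measure S).support)
    (hyμ : Set.range y = (μ : Measure S).support) :
    ∃ γs : ProbabilityMeasure S,
      (γs : Measure S) ≪ (ν : Measure S) ∧
      HasScalingExpansion (lipCb c) μ ν γs ∧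
      (∀ γ : ProbabilityMeasure S, (γ : Measure S) ≪ (ν : Measure S) →
        HasScalingExpansion (lipCb c) μ ν γ → γ = γs) ∧
      (∀ γ : ProbabilityMeasure S, IsEntropyMinimizer (lipCb c) μ ν γ ↔ γ = γs) ∧
      ((∀ (j : Fin M) (i l : Fin N), i ≠ l → c (y j) (x i) ≠ c (y j) (x l)) →
        ∀ i : Fin N, (γs : Measure S) {x i} =
          ∑ j ∈ nearestIndices c x y i, (μ : Measure S) {y j}) := by
  have hfin' : ∀ s t, c s t ≠ ∞ := fun s t => by
    obtain ⟨a, ha⟩ := hfin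
    exact ((ha s t).trans_lt (ENNReal.add_lt_top.2 ⟨ENNReal.coe_lt_top, ENNReal.coe_lt_top⟩)).ne
  have hν := measure_compl_range_eq_zero hxν
  have hμ := measure_compl_range_eq_zero hyμ
  have hw : ∀ i, 0 < weights x ν i := measureReal_singleton_pos hxν
  have hm := weights_mem_stdSimplex hy μ hμ
  have : Nonempty (Fin N) := by
    have h : (ν : Measure S).support.Nonempty :=
      Measure.nonempty_support (IsProbabilityMeasure.ne_zero _)
    rw [← hxν] at h
    exact Set.range_nonempty_iff_nonempty.1 h
  set o : Fin N ⊕ Fin M := .inl (Classical.arbitrary (Fin N))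
  set d := costMatrix c x y with hd
  have hd0 : ∀ p q, 0 ≤ d p q := fun _ _ => ENNReal.toReal_nonneg
  set w := weights x ν
  set m := weights y μ
  obtain ⟨p, hp, hpV, hpR, hpu⟩ := exists_unique_entropy_minimizer (o := o) (m := m) hd0 hw
  set V := discreteTransport d o m
  set R := discreteEntropy w
  obtain ⟨γs, hγs, hγsp⟩ := exists_weights_eq hx hp (ν := (ν : Measure S)) hw
  have hVγ : ∀ γ : ProbabilityMeasure S, (γ : Measure S) ≪ (ν : Measure S) →
      gammaTransport (lipCb c) μ γ = (V (weights x γ) : EReal) := fun γ hγ =>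
    gammaTransport_eq_discreteTransport hfin' hrep hx hy o hμ (hγ hν)
  have hRγ : ∀ γ : ProbabilityMeasure S, (γ : Measure S) ≪ (ν : Measure S) →
      relEntropy γ ν = (R (weights x γ) : EReal) := fun γ hγ =>
    relEntropy_eq_discreteEntropy hx hν hw hγ
  have hPγ : ∀ γ : ProbabilityMeasure S, (γ : Measure S) ≪ (ν : Measure S) →
      weights x γ ∈ stdSimplex ℝ (Fin N) := fun γ hγ => weights_mem_stdSimplex hx γ (hγ hν)
  have huniq : ∀ γ : ProbabilityMeasure S, (γ : Measure S) ≪ (ν : Measure S) →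
      V (weights x γ) ≤ V p → R (weights x γ) ≤ R p → γ = γs := fun γ hγ h1 h2 =>
    eq_of_weights_eq hx (hγ hν) (hγs hν) (by rw [hγsp]; exact hpu _ (hPγ γ hγ) h1 h2)
  -- the divergence is finite and squeezed between the two sides of the duality
  have hGu : ∀ b, 0 < b → gammaDivergence (b • lipCb c) μ ν ≤ ((b * V p + R p : ℝ) : EReal) :=
    fun b hb => gammaDivergence_le hfin' hx hy hμ hν hw hb hp
  have hGl : ∀ b, 0 < b → ∃ q ∈ stdSimplex ℝ (Fin N),
      ((b * V q + R q : ℝ) : EReal) ≤ gammaDivergence (b • lipCb c) μ ν := fun b hb => by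
    obtain ⟨f, hf, q, hq, hle⟩ := exists_discreteObjective_ge (o := o) (m := m) hd0 hw hb
    exact ⟨q, hq, (EReal.coe_le_coe_iff.2 hle).trans
      (discreteObjective_le_gammaDivergence hfin' hrep hx hy hμ hν hw b hf.2)⟩
  have hGreal : ∀ b : ℝ, 0 < b → gammaDivergence (b • lipCb c) μ ν =
      ((gammaDivergence (b • lipCb c) μ ν).toReal : EReal) := fun b hb => by
    obtain ⟨q, -, hq⟩ := hGl b hb
    exact (EReal.coe_toReal ((hGu b hb).trans_lt (EReal.coe_lt_top _)).ne
      ((EReal.bot_lt_coe _).trans_le hq).ne').symm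
  set G : ℝ → ℝ := fun b => (gammaDivergence (b • lipCb c) μ ν).toReal with hG
  have hGu' : ∀ b, 0 < b → G b ≤ b * V p + R p := fun b hb => by
    have := hGu b hb
    rw [hGreal b hb] at this
    exact EReal.coe_le_coe_iff.1 this
  have hlim : Tendsto (fun b => G b - (b * V p + R p)) atTop (𝓝 0) := by
    refine tendsto_penalized_sub (isCompact_stdSimplex ℝ (Fin N))
      continuous_discreteTransport.continuousOn (continuous_discreteEntropy hw).continuousOn
      hpV hpR hGu' fun b hb => ?_
    obtain ⟨q, hq, hle⟩ := hGl b hb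
    rw [hGreal b hb] at hle
    exact ⟨q, hq, EReal.coe_le_coe_iff.1 hle⟩
  have hminT : minTransport (lipCb c) μ ν = (V p : EReal) := by
    apply le_antisymm
    · rw [← hγsp, ← hVγ γs hγs]
      exact iInf₂_le (f := fun (θ : ProbabilityMeasure S)
        (_ : (θ : Measure S) ≪ (ν : Measure S)) => gammaTransport (lipCb c) μ θ) γs hγs
    · refine le_iInf₂ fun θ hθ => ?_
      rw [hVγ θ hθ, EReal.coe_le_coe_iff]
      exact hpV _ (hPγ θ hθ)
  have hVs : gammaTransport (lipCb c) μ γs = (V p : EReal) := by rw [hVγ γs hγs, hγsp]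
  have hRs : relEntropy γs ν = (R p : EReal) := by rw [hRγ γs hγs, hγsp]
  refine ⟨γs, hγs, ⟨?_, ?_, fun b => G b - (b * V p + R p), fun b hb => ?_,
    fun b hb => sub_nonpos.2 (hGu' b hb), hlim⟩, ?_, ?_, ?_⟩
  · rw [hVs]
    exact EReal.coe_ne_top _
  · rw [hRs]
    exact EReal.coe_ne_top _
  · rw [hGreal b hb, hVs, hRs, ← EReal.coe_mul, ← EReal.coe_add, ← EReal.coe_add]
    congr 1
    ring
  · rintro γ hγ ⟨-, -, err, he, -, herr⟩
    -- Subtracting the two expansions of the same divergence leaves a difference of affine functions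
    -- of `b` that tends to zero.
    have h : Tendsto (fun b : ℝ => b * V (weights x γ) + R (weights x γ) - (b * V p + R p))
        atTop (𝓝 0) := by
      have h1 := hlim.sub herr
      rw [sub_zero] at h1
      refine h1.congr' ?_
      filter_upwards [eventually_gt_atTop 0] with b hb
      have h2 := he b hb
      rw [hGreal b hb, hVγ γ hγ, hRγ γ hγ, ← EReal.coe_mul, ← EReal.coe_add, ← EReal.coe_add,
        EReal.coe_eq_coe_iff] at h2
      simp only [hG] at h2 ⊢
      linarith
    obtain ⟨h1, h2⟩ := affine_eq_of_tendsto_sub h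
    exact huniq γ hγ h1.le h2.le
  · refine fun γ => ⟨fun ⟨h1, h2⟩ => ?_, ?_⟩
    · have h3 := h2 γs (hVs.trans hminT.symm)
      -- Competitors are not assumed absolutely continuous; a minimizer is, because its entropy is
      -- at most the finite entropy of `γs`.
      have hγ : (γ : Measure S) ≪ (ν : Measure S) :=
        absolutelyContinuous_of_relEntropy_ne_top
          (h3.trans_lt (hRs ▸ EReal.coe_lt_top _)).ne
      rw [hVγ γ hγ, hminT, EReal.coe_eq_coe_iff] at h1
      rw [hRγ γ hγ, hRs, EReal.coe_le_coe_iff] at h3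
      exact huniq γ hγ h1.le h3
    · rintro rfl
      refine ⟨hVs.trans hminT.symm, fun γ' h' => ?_⟩
      by_cases hγ' : (γ' : Measure S) ≪ (ν : Measure S)
      · rw [hVγ γ' hγ', hminT, EReal.coe_eq_coe_iff] at h'
        rw [hRs, hRγ γ' hγ', EReal.coe_le_coe_iff]
        exact hpR _ (hPγ γ' hγ') h'.le
      · have : relEntropy γ' ν = ⊤ := by
          by_contra h
          exact hγ' (absolutelyContinuous_of_relEntropy_ne_top h)
        rw [this]
        exact le_top
  · intro hne i
    have hmin : ∀ j, ∃ i, ∀ l, c (y j) (x i) ≤ c (y j) (x l) := fun j =>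
      Finite.exists_min fun i => c (y j) (x i)
    choose n hn using hmin
    -- The absence of ties makes the chosen nearest point strictly nearest.
    have hn' : ∀ j i, i ≠ n j → d (.inr j) (.inl (n j)) < d (.inr j) (.inl i) := fun j i hi =>
      (ENNReal.toReal_lt_toReal (hfin' _ _) (hfin' _ _)).2
        (lt_of_le_of_ne (hn j i) (hne j _ _ hi.symm))
    have hpi := eq_sum_of_discreteTransport_le hd0
      (fun q => by simp [hd, costMatrix, cost_self hrep])
      (fun q r s => by
        simp only [hd, costMatrix]
        rw [← ENNReal.toReal_add (hfin' _ _) (hfin' _ _)]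
        exact ENNReal.toReal_mono (ENNReal.add_ne_top.2 ⟨hfin' _ _, hfin' _ _⟩)
          (cost_triangle hrep _ _ _)) hm hp hpV n hn' i
    have hset : nearestIndices c x y i = Finset.univ.filter fun j => n j = i := by
      ext j
      simp only [nearestIndices, Finset.mem_filter, Finset.mem_univ, true_and]
      constructor
      · intro h
        by_contra hni
        exact hne j _ _ hni (le_antisymm (hn j i) (h (n j)))
      · rintro rfl
        exact hn j
    rw [hset, ← ENNReal.toReal_eq_toReal_iff' (measure_ne_top _ _)
      (ENNReal.sum_ne_top.2 fun _ _ => measure_ne_top _ _),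
      ENNReal.toReal_sum fun _ _ => measure_ne_top _ _]
    exact (congrFun hγsp i).trans hpi
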